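/- Let $\mathcal X_1,\dots,\mathcal X_J$ be separable metric spaces, each with at least two points and with its Borel σ-algebra, and let $K\ge 0$. A *binary latent causal model* (BLCM) with $K$ latent variables consists of a directed graph $G$ on binary latent variables $H=(H_1,\dots,H_K)\in\{0,1\}^K$ and observed variables $X=(X_1,\dots,X_J)\in\prod_j\mathcal X_j$, and a joint probability distribution $\mathbb P$ of $(H,X)$, such that: - $G$ is acyclic, with no edges out of observed variables; its edges are those of the latent graph $\Lambda$ on $H_1,\dots,H_K$ and those given by the binary $J\times K$ matrix $\Gamma=(\gamma_{j,k})$, where $\gamma_{j,k}=1$ iff $H_k\to X_j$; - $\mathbb P(H,X)=\prod_k\mathbb P(H_k\mid \mathrm{pa}(H_k))\prod_j\mathbb P(X_j\mid\mathrm{pa}(X_j))$, and $\mathbb P$ is faithful to $G$: for pairwise disjoint sets $A,B,S$ of variables, $A$ and $B$ are conditionally independent given $S$ iff $S$ d-separates $A$ and $B$ in $G$; - $\pi_h:=\mathbb P(H=h)>0$ for all $h\in\{0,1\}^K$; for each $j$, distinct configurations of $\mathrm{pa}(X_j)$ give distinct conditional distributions of $X_j$; and $\Gamma$ has no zero column.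 Write $\mathbb P_{j,h}:=\mathbb P(X_j\in\cdot\mid H=h)$. For Borel sets $C_j\subsetneq\mathcal X_j$, $j=1,\dots,J$, a BLCM is *monotone with respect to $(C_j)_j$* if $$\mathbb P_{j,h}(C_j)>\mathbb P_{j,h'}(C_j)$$ for all $j$ and all $h,h'\in\{0,1\}^K$ such that $h_k\ge h'_k$ for every parent $H_k$ of $X_j$, with strict inequality for at least one such $k$. A $K\times K$ binary matrix is *triangular* if, after some row and column permutations, it is lower triangular with all diagonal entries equal to $1$. **Proposition.** Fix $K$ and Borel sets $C_j\subsetneq\mathcal X_j$. Let $(\Lambda,\Gamma,\mathbb P)$ be a BLCM with $K$ latent variables that is monotone with respect to $(C_j)_j$, and suppose that the rows of $\Gamma$ can be permuted so that $\Gamma=\begin{pmatrix}\Gamma_1\\ \Gamma_2\\ \Gamma_3\end{pmatrix}$, where (i) $\Gamma_1$ and $\Gamma_2$ are $K\times K$ triangular matrices (possibly with different permutations), and (ii) no column of $\Gamma_3$ is zero. Let $(\widetilde\Lambda,\widetilde\Gamma,\widetilde{\mathbb P})$ be any BLCM with $K$ latent variables and the same observed spaces that is monotone with respect to the same sets $(C_j)_j$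 and has the same observed distribution, $\widetilde{\mathbb P}(X)=\mathbb P(X)$. Then the two models agree up to a permutation of the latent labels and Markov equivalence of the latent graph, with no sign-flipping: there is a permutation $\sigma$ of $\{1,\dots,K\}$ such that, for all $h\in\{0,1\}^K$, $j$ and $k$, $$\pi_h=\widetilde\pi_{\tilde h},\qquad \gamma_{j,k}=\widetilde\gamma_{j,\sigma(k)},\qquad \mathbb P_{j,h}=\widetilde{\mathbb P}_{j,\tilde h},\qquad\text{where } \tilde h_{\sigma(k)}=h_k \text{ for all } k,$$ and such that, after renaming each vertex $\sigma(k)$ of $\widetilde\Lambda$ to $k$, the graphs $\Lambda$ and $\widetilde\Lambda$ have the same d-separation relations. -/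

import Mathlib

open MeasureTheory ProbabilityTheory Set

/-! Directed graphs on a vertex type `V` are relations `E : V → V → Prop`, `E a b` meaning `a → b`. -/

/-- A trail: a path in the skeleton of the directed graph `E`, without repeated vertices. -/
def IsTrail {V : Type*} (E : V → V → Prop) (l : List V) : Prop :=
  l.Nodup ∧ l.IsChain (fun a b => E a b ∨ E b a)

/-- A trail is active given `C` when every collider `a → b ← c` on it has a descendant in `C`
(a vertex counts as its own descendant) and no other interior vertex `b` of it is in `C`. -/
def IsActive {V : Type*} (E : V → V → Prop) (C : Set V) (l : List V) : Prop :=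
  ∀ a b c : V, [a, b, c] <:+: l →
    ((E a b ∧ E c b) → ∃ d ∈ C, Relation.ReflTransGen E b d) ∧
    (¬ (E a b ∧ E c b) → b ∉ C)

/-- d-separation of `A` and `B` by `C`: no trail from `A` to `B` is active given `C`. -/
def DSep {V : Type*} (E : V → V → Prop) (A B C : Set V) : Prop :=
  ∀ l : List V, IsTrail E l → (∃ a ∈ A, l.head? = some a) → (∃ b ∈ B, l.getLast? = some b) →
    ¬ IsActive E C l

/-- Two directed graphs on the same vertices are Markov equivalent: they induce the same
conditional independence relations (d-separations). -/
def MarkovEquiv {V : Type*} (E E' : V → V → Prop) : Prop :=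
  ∀ A B C : Set V, Disjoint A B → Disjoint A C → Disjoint B C →
    (DSep E A B C ↔ DSep E' A B C)

/-- A graphical model with `K` binary latent variables `H` and `J` observed variables `X j` in
`𝒳 j`: a latent graph `Λ` (`Λ l k` means `H_l → H_k`), the `J × K` binary adjacency matrix `Γ`
(`Γ j k = true` means `H_k → X_j`), and a joint distribution of `(H, X)`. There are no edges out of
observed variables. -/
structure LatentModel (K J : ℕ) (𝒳 : Fin J → Type*) [∀ j, MeasurableSpace (𝒳 j)] where
  Λ : Fin K → Fin K → Prop
  Γ : Matrix (Fin J) (Fin K) Bool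
  law : Measure ((Fin K → Bool) × (∀ j, 𝒳 j))

namespace LatentModel

variable {K J : ℕ} {𝒳 : Fin J → Type*} [∀ j, MeasurableSpace (𝒳 j)]

/-- The full directed graph `G` on the vertices `V = (H, X)`, with edges `Λ ∪ Γ`. -/
def edge (M : LatentModel K J 𝒳) : Fin K ⊕ Fin J → Fin K ⊕ Fin J → Prop
  | .inl l, .inl k => M.Λ l k
  | .inl k, .inr j => M.Γ j k = true
  | .inr _, _ => False

/-- `π_h = P(H = h)`. -/
noncomputable def latentProb (M : LatentModel K J 𝒳) (h : Fin K → Bool) : ENNReal :=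
  M.law {ω | ω.1 = h}

/-- `P_{j,h} = P(X_j ∈ · | H = h)`. -/
noncomputable def obsCond (M : LatentModel K J 𝒳) (j : Fin J) (h : Fin K → Bool) :
    Measure (𝒳 j) :=
  (M.law[|{ω | ω.1 = h}]).map (fun ω => ω.2 j)

/-- `P(X_j ∈ · | pa(X_j) = h_{pa(X_j)})`. -/
noncomputable def obsCondPa (M : LatentModel K J 𝒳) (j : Fin J) (h : Fin K → Bool) :
    Measure (𝒳 j) :=
  (M.law[|{ω | ∀ k, M.Γ j k = true → ω.1 k = h k}]).map (fun ω => ω.2 j)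

/-- `P(H_k = h_k | pa(H_k) = h_{pa(H_k)})`. -/
noncomputable def latentCondPa (M : LatentModel K J 𝒳) (k : Fin K) (h : Fin K → Bool) : ENNReal :=
  M.law[{ω | ω.1 k = h k} | {ω | ∀ l, M.Λ l k → ω.1 l = h l}]

/-- The marginal distribution `P(X)` of all observed variables. -/
noncomputable def obsLaw (M : LatentModel K J 𝒳) : Measure (∀ j, 𝒳 j) :=
  M.law.map Prod.snd

/-- The σ-algebra generated by a single variable of `V = (H, X)`. -/
@[reducible] def varSigma (K : ℕ) {J : ℕ} (𝒳 : Fin J → Type*) [∀ j, MeasurableSpace (𝒳 j)] :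
    Fin K ⊕ Fin J → MeasurableSpace ((Fin K → Bool) × (∀ j, 𝒳 j))
  | .inl k => MeasurableSpace.comap (fun ω => ω.1 k) inferInstance
  | .inr j => MeasurableSpace.comap (fun ω => ω.2 j) inferInstance

/-- The σ-algebra generated by the variables in a set `S ⊆ V`. -/
@[reducible] def setSigma (K : ℕ) {J : ℕ} (𝒳 : Fin J → Type*) [∀ j, MeasurableSpace (𝒳 j)]
    (S : Set (Fin K ⊕ Fin J)) : MeasurableSpace ((Fin K → Bool) × (∀ j, 𝒳 j)) :=
  ⨆ v ∈ S, varSigma K 𝒳 v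

/-- Conditional independence `V_A ⊥ V_B | V_C` under the joint distribution, by conditional
probabilities given the σ-algebra of `V_C`. -/
def CondIndepVars (M : LatentModel K J 𝒳) (A B C : Set (Fin K ⊕ Fin J)) : Prop :=
  ∀ s t : Set ((Fin K → Bool) × (∀ j, 𝒳 j)),
    MeasurableSet[setSigma K 𝒳 A] s → MeasurableSet[setSigma K 𝒳 B] t →
      M.law⟦s ∩ t | setSigma K 𝒳 C⟧ =ᵐ[M.law]
        M.law⟦s | setSigma K 𝒳 C⟧ * M.law⟦t | setSigma K 𝒳 C⟧

/-- Binary latent causal models. -/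
structure IsBLCM (M : LatentModel K J 𝒳) : Prop where
  isProbabilityMeasure : IsProbabilityMeasure M.law
  /-- the graph is a DAG -/
  acyclic : ∀ v, ¬ Relation.TransGen M.edge v v
  /-- the causal Markov factorization
  `P(V) = ∏ k, P(H_k | pa(H_k)) * ∏ j, P(X_j | pa(X_j))` -/
  markov : ∀ (h : Fin K → Bool) (B : ∀ j, Set (𝒳 j)), (∀ j, MeasurableSet (B j)) →
    M.law {ω | ω.1 = h ∧ ∀ j, ω.2 j ∈ B j} =
      (∏ k, M.latentCondPa k h) * ∏ j, M.obsCondPa j h (B j)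
  /-- the conditional independences of the distribution are exactly those of the graph -/
  faithful : ∀ A B C : Set (Fin K ⊕ Fin J), Disjoint A B → Disjoint A C → Disjoint B C →
    (DSep M.edge A B C ↔ M.CondIndepVars A B C)
  /-- all latent configurations have positive probability -/
  latentProb_pos : ∀ h, 0 < M.latentProb h
  /-- distinct configurations of the parents of `X_j` give distinct conditional laws of `X_j` -/
  obsCondPa_ne : ∀ (j : Fin J) (h h' : Fin K → Bool), (∃ k, M.Γ j k = true ∧ h k ≠ h' k) →
    M.obsCondPa j h ≠ M.obsCondPa j h'
  /-- each latent variable has an observed child -/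
  exists_child : ∀ k, ∃ j, M.Γ j k = true

/-- Monotonicity with respect to the baseline sets `C j`: `P_{j,h}(C_j) > P_{j,h'}(C_j)` whenever
`h_{pa(X_j)} ≻ h'_{pa(X_j)}`, i.e. `≥` in every coordinate and different. -/
def Monotone (M : LatentModel K J 𝒳) (C : ∀ j, Set (𝒳 j)) : Prop :=
  ∀ (j : Fin J) (h h' : Fin K → Bool),
    (∀ k, M.Γ j k = true → h' k ≤ h k) → (∃ k, M.Γ j k = true ∧ h k ≠ h' k) →
      M.obsCond j h' (C j) < M.obsCond j h (C j)

/-- Equality of all model components up to a relabelling `H_k ↦ H_{σ k}` of the latent variables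
and Markov equivalence of the latent graphs, *without* sign flips. The configuration `h` of the
first model corresponds to the configuration `h'` of the second with `h' (σ k) = h k`. -/
def EquivUpToLabels (M M' : LatentModel K J 𝒳) : Prop :=
  ∃ σ : Equiv.Perm (Fin K),
    (∀ h : Fin K → Bool, M.latentProb h = M'.latentProb (h ∘ σ.symm)) ∧
    (∀ j k, M.Γ j k = M'.Γ j (σ k)) ∧
    (∀ j (h : Fin K → Bool), M.obsCond j h = M'.obsCond j (h ∘ σ.symm)) ∧
    MarkovEquiv M.Λ (fun k l => M'.Λ (σ k) (σ l))

end LatentModel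

/-- A square binary matrix is triangular when some row and column permutations make it lower
triangular with ones on the diagonal. -/
def IsTriangularUpToPerm {K : ℕ} (G : Matrix (Fin K) (Fin K) Bool) : Prop :=
  ∃ ρ c : Equiv.Perm (Fin K),
    (∀ i, G (ρ i) (c i) = true) ∧ ∀ i l, i < l → G (ρ i) (c l) = false

/-- `Γ` is double triangular, with the blocks `Γ₁` and `Γ₂` given by the rows listed by `r₁` and
`r₂`; the remaining rows form `Γ₃`. -/
def IsDoubleTriangular {K J : ℕ} (Γ : Matrix (Fin J) (Fin K) Bool) (r₁ r₂ : Fin K ↪ Fin J) : Prop :=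
  Disjoint (range r₁) (range r₂) ∧
    IsTriangularUpToPerm (Γ.submatrix r₁ id) ∧ IsTriangularUpToPerm (Γ.submatrix r₂ id)

/-- No column of the remaining block `Γ₃` is empty. -/
def ThirdBlockNoEmptyColumn {K J : ℕ} (Γ : Matrix (Fin J) (Fin K) Bool) (r₁ r₂ : Fin K ↪ Fin J) :
    Prop :=
  ∀ k, ∃ j, j ∉ range r₁ ∧ j ∉ range r₂ ∧ Γ j k = true

/-!
The factorization makes the observed law a mixture, over the latent configurations `h`, of the product
measures `∏ j, P_{j,h}`, where `P_{j,h}` determines, and is determined by, the restriction of `h` to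
the parents of `X_j`. A triangular block of `Γ` together with monotonicity yields product functions
`u_h` of the block with `E[u_h | H = g] = 1_{g = h}`
(`LatentModel.IsBLCM.exists_condMean_eq_indicator`). Let `A` and `B` be the matrices of the means of
these functions, for the two blocks, given the configurations of the second model. Equality of the
observed laws gives `A D' Bᵀ = D`, with `D` and `D'` the diagonal matrices of the latent
probabilities, and hence `F A = A F'` for the diagonal matrices `F` and `F'` of the conditional means
of any function of the remaining variables. These means separate the configurations of the first
model, so `A` is a scaled permutation matrix (`exists_perm_of_diagonal_factorization`). This is
Kruskal's uniqueness theorem in an explicit case, and it matches the components of the two mixtures by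
a bijection `φ` between latent configurations (`LatentModel.IsBLCM.exists_perm_obsCond_eq`).

The bijection `φ` matches, for each `j`, agreement on the parents of `X_j` in the two models. Along the
triangular order, this forces the second `Γ`-matrix to be triangular on the same rows
(`exists_perm_triangular_of_partition_eq`), and `φ` to act on the corresponding coordinates up to flips
that depend on the preceding coordinates. Monotonicity in both models excludes flips, so that `φ` comes
from a permutation `σ` of the latent variables (`LatentModel.IsBLCM.exists_perm_apply_eq`), which then
carries parents to parents.

The laws of `H` in the two models thus agree up to `σ`. A trail through an observed vertex is blocked
there, so d-separation of latent variables in the full graph is d-separation in the latent graph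
(`dSep_image_iff`). By faithfulness it is conditional independence under the law of `H`
(`LatentModel.IsBLCM.dSep_latent_iff_cubeCondIndep`), whence the latent graphs are Markov equivalent.
-/

/-! ### The factorization as a finite mixture of product measures -/

namespace LatentModel

variable {K J : ℕ} {𝒳 : Fin J → Type*} [∀ j, MeasurableSpace (𝒳 j)]

lemma measurableSet_latent_eq (h : Fin K → Bool) :
    MeasurableSet {ω : (Fin K → Bool) × (∀ j, 𝒳 j) | ω.1 = h} :=
  measurable_fst (measurableSet_singleton h)

namespace IsBLCM

variable {M : LatentModel K J 𝒳}

lemma latentProb_ne_top (hM : M.IsBLCM) (h : Fin K → Bool) : M.latentProb h ≠ ⊤ :=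
  have := hM.isProbabilityMeasure
  measure_ne_top _ _

lemma isProbabilityMeasure_obsCond (hM : M.IsBLCM) (j : Fin J) (h : Fin K → Bool) :
    IsProbabilityMeasure (M.obsCond j h) := by
  have := hM.isProbabilityMeasure
  have : IsProbabilityMeasure (M.law[|{ω | ω.1 = h}]) :=
    cond_isProbabilityMeasure (hM.latentProb_pos h).ne'
  exact Measure.isProbabilityMeasure_map (by fun_prop)

lemma isProbabilityMeasure_obsCondPa (hM : M.IsBLCM) (j : Fin J) (h : Fin K → Bool) :
    IsProbabilityMeasure (M.obsCondPa j h) := by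
  have := hM.isProbabilityMeasure
  have : IsProbabilityMeasure (M.law[|{ω | ∀ k, M.Γ j k = true → ω.1 k = h k}]) := by
    refine cond_isProbabilityMeasure ((hM.latentProb_pos h).trans_le (measure_mono ?_)).ne'
    rintro ω rfl k -
    rfl
  exact Measure.isProbabilityMeasure_map (by fun_prop)

lemma law_rect_obsCondPa (hM : M.IsBLCM) (h : Fin K → Bool) {B : ∀ j, Set (𝒳 j)}
    (hB : ∀ j, MeasurableSet (B j)) :
    M.law {ω | ω.1 = h ∧ ∀ j, ω.2 j ∈ B j} = M.latentProb h * ∏ j, M.obsCondPa j h (B j) := by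
  have h1 := hM.markov h (fun _ => univ) (fun _ => MeasurableSet.univ)
  have h2 : ∀ j, M.obsCondPa j h univ = 1 := fun j =>
    (hM.isProbabilityMeasure_obsCondPa j h).measure_univ
  simp only [mem_univ, implies_true, and_true, h2, Finset.prod_const_one, mul_one] at h1
  rw [hM.markov h B hB, latentProb, h1]

/-- Given the whole latent configuration, `X_j` is distributed as it is given its parents alone. -/
lemma obsCond_eq_obsCondPa (hM : M.IsBLCM) (j : Fin J) (h : Fin K → Bool) :
    M.obsCond j h = M.obsCondPa j h := by
  classical
  ext s hs
  have hB : ∀ i, MeasurableSet (Function.update (fun i => (univ : Set (𝒳 i))) j s i) := by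
    intro i
    by_cases hi : i = j
    · subst hi; simpa using hs
    · simp [hi]
  have h1 := hM.law_rect_obsCondPa h hB
  have h2 : ∏ i, M.obsCondPa i h (Function.update (fun i => (univ : Set (𝒳 i))) j s i)
      = M.obsCondPa j h s := by
    rw [Finset.prod_eq_single j]
    · simp
    · intro i _ hi
      simpa [hi] using (hM.isProbabilityMeasure_obsCondPa i h).measure_univ
    · simp
  have h3 : {ω : (Fin K → Bool) × (∀ j, 𝒳 j) | ω.1 = h ∧
      ∀ i, ω.2 i ∈ Function.update (fun i => (univ : Set (𝒳 i))) j s i}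
      = {ω | ω.1 = h} ∩ (fun ω => ω.2 j) ⁻¹' s := by
    ext ω
    simp only [mem_ofPred_eq, mem_inter_iff, mem_preimage, and_congr_right_iff]
    intro _
    constructor
    · intro H; simpa using H j
    · intro H i
      by_cases hi : i = j
      · subst hi; simpa using H
      · simp [hi]
  rw [h2, h3] at h1
  rw [obsCond, Measure.map_apply (by fun_prop) hs, cond_apply (measurableSet_latent_eq h), h1]
  exact ENNReal.inv_mul_cancel_left (hM.latentProb_pos h).ne' (hM.latentProb_ne_top h)

lemma obsCond_eq_iff (hM : M.IsBLCM) (j : Fin J) (h h' : Fin K → Bool) :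
    M.obsCond j h = M.obsCond j h' ↔ ∀ k, M.Γ j k = true → h k = h' k := by
  rw [hM.obsCond_eq_obsCondPa, hM.obsCond_eq_obsCondPa]
  constructor
  · intro H
    by_contra! hne
    exact hM.obsCondPa_ne j h h' hne H
  · intro H
    have : {ω : (Fin K → Bool) × (∀ j, 𝒳 j) | ∀ k, M.Γ j k = true → ω.1 k = h k}
        = {ω | ∀ k, M.Γ j k = true → ω.1 k = h' k} := by
      ext ω
      exact forall₂_congr fun k hk => by rw [H k hk]
    rw [obsCondPa, obsCondPa, this]

lemma obsLaw_eq (hM : M.IsBLCM) :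
    M.obsLaw = ∑ h, M.latentProb h • Measure.pi (fun j => M.obsCond j h) := by
  have := hM.isProbabilityMeasure
  have := fun j h => hM.isProbabilityMeasure_obsCond j h
  have hcond : ∀ h, (M.law[|{ω | ω.1 = h}]).map Prod.snd
      = Measure.pi (fun j => M.obsCond j h) := by
    intro h
    refine (Measure.pi_eq fun s hs => ?_).symm
    rw [Measure.map_apply measurable_snd (MeasurableSet.univ_pi hs),
      cond_apply (measurableSet_latent_eq h)]
    have h3 : {ω : (Fin K → Bool) × (∀ j, 𝒳 j) | ω.1 = h} ∩ Prod.snd ⁻¹' (univ.pi s)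
        = {ω | ω.1 = h ∧ ∀ j, ω.2 j ∈ s j} := by
      ext ω; simp
    rw [h3, hM.law_rect_obsCondPa h hs]
    simp_rw [hM.obsCond_eq_obsCondPa]
    exact ENNReal.inv_mul_cancel_left (hM.latentProb_pos h).ne' (hM.latentProb_ne_top h)
  ext S hS
  have hlaw := sum_meas_smul_cond_fiber (X := Prod.fst) measurable_fst M.law
  rw [obsLaw, Measure.map_apply measurable_snd hS, ← hlaw]
  simp only [Measure.coe_finsetSum, Measure.coe_smul, Finset.sum_apply, Pi.smul_apply]
  refine Finset.sum_congr rfl fun h _ => ?_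
  rw [← hcond h, Measure.map_apply measurable_snd hS]
  rfl

end IsBLCM

/-- A family of bounded measurable functions, one for each observed variable. It stands for the
product function `x ↦ ∏ j, f j (x j)` of the observed variables. -/
def IsTestFunction (f : ∀ j, 𝒳 j → ℝ) : Prop :=
  ∀ j, Measurable (f j) ∧ ∃ c, ∀ x, |f j x| ≤ c

/-- The conditional expectation `E[∏ j, f j (X_j) | H = h]`, written as a product by the conditional
independence of the observed variables given `H`. -/
noncomputable def condMean (M : LatentModel K J 𝒳) (f : ∀ j, 𝒳 j → ℝ) (h : Fin K → Bool) : ℝ :=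
  ∏ j, ∫ x, f j x ∂(M.obsCond j h)

lemma IsTestFunction.one : IsTestFunction (1 : ∀ j, 𝒳 j → ℝ) :=
  fun _ => ⟨measurable_const, 1, fun _ => by simp⟩

lemma IsTestFunction.mul {f g : ∀ j, 𝒳 j → ℝ} (hf : IsTestFunction f) (hg : IsTestFunction g) :
    IsTestFunction (f * g) := by
  intro j
  obtain ⟨hf1, c, hc⟩ := hf j
  obtain ⟨hg1, d, hd⟩ := hg j
  refine ⟨hf1.mul hg1, c * d, fun x => ?_⟩
  rw [Pi.mul_apply, Pi.mul_apply, abs_mul]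
  exact mul_le_mul (hc x) (hd x) (abs_nonneg _) ((abs_nonneg _).trans (hc x))

namespace IsBLCM

variable {M : LatentModel K J 𝒳}

lemma condMean_one (hM : M.IsBLCM) (h : Fin K → Bool) : M.condMean 1 h = 1 := by
  have := fun j => hM.isProbabilityMeasure_obsCond j h
  simp [condMean]

lemma condMean_mul (hM : M.IsBLCM) {f g : ∀ j, 𝒳 j → ℝ} (hfg : ∀ j, f j = 1 ∨ g j = 1)
    (h : Fin K → Bool) : M.condMean (f * g) h = M.condMean f h * M.condMean g h := by
  have := fun j => hM.isProbabilityMeasure_obsCond j h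
  rw [condMean, condMean, condMean, ← Finset.prod_mul_distrib]
  refine Finset.prod_congr rfl fun j _ => ?_
  rcases hfg j with hj | hj <;> simp [hj]

lemma integral_obsLaw (hM : M.IsBLCM) {f : ∀ j, 𝒳 j → ℝ} (hf : IsTestFunction f) :
    ∫ x, ∏ j, f j (x j) ∂M.obsLaw = ∑ h, (M.latentProb h).toReal * M.condMean f h := by
  have := fun j h => hM.isProbabilityMeasure_obsCond j h
  rw [hM.obsLaw_eq, integral_finsetSum_measure]
  · refine Finset.sum_congr rfl fun h _ => ?_
    rw [integral_smul_measure, integral_fintype_prod_eq_prod, smul_eq_mul, condMean]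
  · intro h _
    refine Integrable.smul_measure ?_ (hM.latentProb_ne_top h)
    choose hm c hc using hf
    refine Integrable.of_bound (C := ∏ j, c j) ?_ (ae_of_all _ fun x => ?_)
    · exact (Finset.measurable_prod _ fun j _ =>
        (hm j).comp (measurable_pi_apply j)).aestronglyMeasurable
    · rw [Real.norm_eq_abs, Finset.abs_prod]
      exact Finset.prod_le_prod (fun _ _ => abs_nonneg _) fun j _ => hc j _

end IsBLCM

end LatentModel

/-! ### Functions of a triangular block that isolate a latent configuration -/

namespace LatentModel

variable {K J : ℕ} {𝒳 : Fin J → Type*} [∀ j, MeasurableSpace (𝒳 j)]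

lemma Monotone.obsCond_lt {M : LatentModel K J 𝒳} {C : ∀ j, Set (𝒳 j)} (hmono : M.Monotone C)
    {j : Fin J} {k : Fin K} {g h : Fin K → Bool} (hk : M.Γ j k = true)
    (hgh : ∀ l, l ≠ k → M.Γ j l = true → g l = h l) (hg : g k = false) (hh : h k = true) :
    M.obsCond j g (C j) < M.obsCond j h (C j) := by
  refine hmono j h g (fun l hl => ?_) ⟨k, hk, by simp [hg, hh]⟩
  by_cases hlk : l = k
  · subst hlk; simp [hg]
  · exact (hgh l hlk hl).le

lemma Monotone.obsCond_ne {M : LatentModel K J 𝒳} {C : ∀ j, Set (𝒳 j)} (hmono : M.Monotone C)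
    {j : Fin J} {k : Fin K} (h : Fin K → Bool) (hk : M.Γ j k = true) :
    M.obsCond j (Function.update h k (!h k)) (C j) ≠ M.obsCond j h (C j) := by
  rcases hh : h k with _ | _
  · refine (hmono.obsCond_lt hk (fun l hl _ => ?_) hh (by simp)).ne'
    simp [hl]
  · refine (hmono.obsCond_lt hk (fun l hl _ => ?_) (by simp) hh).ne
    simp [hl]

/-- A triangular block carries, for each latent configuration `h`, a product function of the observed
variables of the block whose conditional mean given `H` is the indicator of `h`. In the triangular
order, the factor of row `i` is `1_{C_i} - a_i`, normalized, where `a_i` is the conditional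
probability of `C_i` at `h` with the diagonal coordinate flipped; for `g ≠ h` the factor at the first
coordinate where `g` and `h` differ has conditional mean zero given `g`. -/
lemma IsBLCM.exists_condMean_eq_indicator {M : LatentModel K J 𝒳} (hM : M.IsBLCM)
    {C : ∀ j, Set (𝒳 j)} (hC : ∀ j, MeasurableSet (C j)) (hmono : M.Monotone C)
    (r : Fin K ↪ Fin J) (hr : IsTriangularUpToPerm (M.Γ.submatrix r id)) (h : Fin K → Bool) :
    ∃ u : ∀ j, 𝒳 j → ℝ, IsTestFunction u ∧ (∀ j, j ∉ range r → u j = 1) ∧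
      ∀ g, M.condMean u g = if g = h then 1 else 0 := by
  classical
  have := fun j h => hM.isProbabilityMeasure_obsCond j h
  obtain ⟨ρ, c, hdiag, hup⟩ := hr
  simp only [Matrix.submatrix_apply, id_eq] at hdiag hup
  have hinj : Function.Injective (fun i => r (ρ i)) := r.injective.comp ρ.injective
  let θ : ∀ j, (Fin K → Bool) → ℝ := fun j g => (M.obsCond j g).real (C j)
  let a : ∀ j, (∃ i, r (ρ i) = j) → ℝ := fun j hj =>
    θ j (Function.update h (c hj.choose) (!h (c hj.choose)))
  let u : ∀ j, 𝒳 j → ℝ := fun j => if hj : ∃ i, r (ρ i) = j then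
    fun x => ((C j).indicator 1 x - a j hj) / (θ j h - a j hj) else 1
  have hint : ∀ i g, ∫ x, u (r (ρ i)) x ∂(M.obsCond (r (ρ i)) g) =
      (θ (r (ρ i)) g - θ (r (ρ i)) (Function.update h (c i) (!h (c i)))) /
        (θ (r (ρ i)) h - θ (r (ρ i)) (Function.update h (c i) (!h (c i)))) := by
    intro i g
    have hj : ∃ i', r (ρ i') = r (ρ i) := ⟨i, rfl⟩
    have hi : hj.choose = i := hinj hj.choose_spec
    simp only [u, hj, dite_true, a, hi]
    rw [integral_div, integral_sub ((integrable_const 1).indicator (hC _)) (integrable_const _),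
      integral_const, integral_indicator_one (hC _)]
    simp [θ]
  have hne : ∀ i, θ (r (ρ i)) h - θ (r (ρ i)) (Function.update h (c i) (!h (c i))) ≠ 0 := by
    intro i
    rw [sub_ne_zero]
    intro H
    refine hmono.obsCond_ne h (hdiag i) ?_
    exact ((ENNReal.toReal_eq_toReal_iff' (measure_ne_top _ _) (measure_ne_top _ _)).1 H).symm
  refine ⟨u, fun j => ?_, fun j hj => ?_, fun g => ?_⟩
  · by_cases hj : ∃ i, r (ρ i) = j
    · simp only [u, hj, dite_true]
      refine ⟨((measurable_const.indicator (hC j)).sub_const _).div_const _,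
        (1 + |a j hj|) / |θ j h - a j hj|, fun x => ?_⟩
      rw [abs_div]
      gcongr
      refine (abs_sub _ _).trans ?_
      gcongr
      by_cases hx : x ∈ C j <;> simp [hx]
    · simp only [u, hj, dite_false]
      exact IsTestFunction.one j
  · have : ¬ ∃ i, r (ρ i) = j := fun ⟨i, hi⟩ => hj ⟨ρ i, hi⟩
    simp only [u, this, dite_false]
  · split_ifs with hg
    · subst hg
      refine Finset.prod_eq_one fun j _ => ?_
      by_cases hj : ∃ i, r (ρ i) = j
      · obtain ⟨i, rfl⟩ := hj
        rw [hint, div_self (hne i)]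
      · simp [u, hj]
    · have hex : ∃ i, g (c i) ≠ h (c i) := by
        by_contra! H
        exact hg (funext fun k => by simpa using H (c.symm k))
      obtain ⟨i, hi, hmin⟩ := WellFounded.has_min (wellFounded_lt (α := Fin K))
        {i | g (c i) ≠ h (c i)} hex
      refine Finset.prod_eq_zero (Finset.mem_univ (r (ρ i))) ?_
      rw [hint, div_eq_zero_iff, sub_eq_zero]
      left
      have : M.obsCond (r (ρ i)) g
          = M.obsCond (r (ρ i)) (Function.update h (c i) (!h (c i))) := by
        refine (hM.obsCond_eq_iff _ _ _).2 fun k hk => ?_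
        obtain ⟨l, rfl⟩ := c.surjective k
        rcases lt_trichotomy l i with hl | rfl | hl
        · have h1 : c l ≠ c i := fun H => hl.ne (c.injective H)
          rw [Function.update_of_ne h1]
          by_contra H
          exact hmin l H hl
        · have := hi.out
          revert this
          simp only [Function.update_self]
          cases g (c l) <;> cases h (c l) <;> simp
        · simp [hup i l hl] at hk
      simp only [θ, this]

end LatentModel

/-! ### Matching the latent configurations of two mixtures -/

/-- The algebraic core of Kruskal's uniqueness of three-way decompositions, with the first two
factors of one decomposition normalized to be the identity: `A` intertwines the diagonal matrices
of the third factors, so it is a permutation matrix up to scaling. -/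
lemma exists_perm_of_diagonal_factorization {H I : Type*} [Fintype H] [DecidableEq H]
    {π π' : H → ℝ} (hπ : ∀ h, π h ≠ 0) {A B : Matrix H H ℝ}
    (hAB : A * Matrix.diagonal π' * B.transpose = Matrix.diagonal π) {F F' : I → H → ℝ}
    (hF : ∀ i, A * Matrix.diagonal (π' * F' i) * B.transpose = Matrix.diagonal (π * F i))
    (hsep : ∀ g h, (∀ i, F i g = F i h) → g = h) :
    ∃ φ : Equiv.Perm H, (∀ i h, F i h = F' i (φ h)) ∧ ∀ g h, g ≠ φ h → A h g = 0 := by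
  have hdet : A.det * ((Matrix.diagonal π').det * B.transpose.det) ≠ 0 := by
    rw [← mul_assoc, ← Matrix.det_mul, ← Matrix.det_mul, hAB, Matrix.det_diagonal]
    exact Finset.prod_ne_zero_iff.2 fun h _ => hπ h
  have hA : A.det ≠ 0 := left_ne_zero_of_mul hdet
  have hP : IsUnit (Matrix.diagonal π' * B.transpose) := by
    rw [Matrix.isUnit_iff_isUnit_det, Matrix.det_mul, isUnit_iff_ne_zero]
    exact right_ne_zero_of_mul hdet
  have hcomm : ∀ i, Matrix.diagonal (F i) * A = A * Matrix.diagonal (F' i) := by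
    intro i
    refine hP.mul_left_injective ?_
    have h1 := hF i
    have h2 : (Matrix.diagonal (π' * F' i) : Matrix H H ℝ)
        = Matrix.diagonal (F' i) * Matrix.diagonal π' := by
      rw [Matrix.diagonal_mul_diagonal]
      congr 1; ext; simp [mul_comm]
    have h3 : (Matrix.diagonal (π * F i) : Matrix H H ℝ)
        = Matrix.diagonal (F i) * Matrix.diagonal π := by
      rw [Matrix.diagonal_mul_diagonal]
      congr 1; ext; simp [mul_comm]
    rw [h2, h3, ← hAB] at h1
    simpa only [mul_assoc] using h1.symm
  have hmatch : ∀ h g, A h g ≠ 0 → ∀ i, F i h = F' i g := by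
    intro h g hhg i
    have h1 := congrFun (congrFun (hcomm i) h) g
    rw [Matrix.diagonal_mul, Matrix.mul_diagonal, mul_comm] at h1
    exact mul_left_cancel₀ hhg h1
  have hrow : ∀ h, ∃ g, A h g ≠ 0 := by
    intro h
    by_contra! H
    exact hA (Matrix.det_eq_zero_of_row_eq_zero h H)
  choose φ hφ using hrow
  have hinj : Function.Injective φ := fun g h hgh =>
    hsep g h fun i => by rw [hmatch g _ (hφ g), hmatch h _ (hφ h), hgh]
  refine ⟨Equiv.ofBijective φ (Finite.injective_iff_bijective.1 hinj),
    fun i h => hmatch h _ (hφ h) i, fun g h hg => ?_⟩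
  by_contra H
  obtain ⟨h', rfl⟩ := (Finite.injective_iff_surjective.1 hinj) g
  have : h = h' := hsep h h' fun i => by rw [hmatch h _ H, hmatch h' _ (hφ h')]
  exact hg (by simp [this])

namespace LatentModel

variable {K J : ℕ} {𝒳 : Fin J → Type*} [∀ j, MeasurableSpace (𝒳 j)]

/-- The test function `1_B(x_j)` of a single observed variable. -/
noncomputable def singleTest (j : Fin J) (B : Set (𝒳 j)) : ∀ i, 𝒳 i → ℝ :=
  Function.update 1 j (B.indicator 1)

lemma isTestFunction_singleTest {j : Fin J} {B : Set (𝒳 j)} (hB : MeasurableSet B) :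
    IsTestFunction (singleTest j B) := by
  intro i
  by_cases hi : i = j
  · subst hi
    rw [singleTest, Function.update_self]
    refine ⟨measurable_const.indicator hB, 1, fun x => ?_⟩
    by_cases hx : x ∈ B <;> simp [hx]
  · rw [singleTest, Function.update_of_ne hi]
    exact IsTestFunction.one i

namespace IsBLCM

variable {M : LatentModel K J 𝒳}

lemma condMean_singleTest (hM : M.IsBLCM) {j : Fin J} {B : Set (𝒳 j)} (hB : MeasurableSet B)
    (h : Fin K → Bool) : M.condMean (singleTest j B) h = (M.obsCond j h).real B := by
  have := fun j => hM.isProbabilityMeasure_obsCond j h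
  rw [condMean, Finset.prod_eq_single j]
  · rw [singleTest, Function.update_self, integral_indicator_one hB]
  · intro i _ hi
    simp [singleTest, hi]
  · simp

lemma obsCond_ext {M' : LatentModel K J 𝒳} (hM : M.IsBLCM) (hM' : M'.IsBLCM) {j : Fin J}
    {g h : Fin K → Bool}
    (H : ∀ B, MeasurableSet B → (M.obsCond j g).real B = (M'.obsCond j h).real B) :
    M.obsCond j g = M'.obsCond j h := by
  have := hM.isProbabilityMeasure_obsCond j g
  have := hM'.isProbabilityMeasure_obsCond j h
  ext B hB
  exact (ENNReal.toReal_eq_toReal_iff' (measure_ne_top _ _) (measure_ne_top _ _)).1 (H B hB)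

/-- The laws of the observed variables outside of the two blocks identify the latent
configuration. -/
lemma eq_of_obsCond_eq_off (hM : M.IsBLCM) {r₁ r₂ : Fin K ↪ Fin J}
    (h3 : ThirdBlockNoEmptyColumn M.Γ r₁ r₂) {g h : Fin K → Bool}
    (H : ∀ j, j ∉ range r₁ → j ∉ range r₂ → M.obsCond j g = M.obsCond j h) : g = h := by
  funext k
  obtain ⟨j, hj1, hj2, hjk⟩ := h3 k
  exact (hM.obsCond_eq_iff j g h).1 (H j hj1 hj2) k hjk

/-- The components of the two mixtures agree, up to a bijection, in the laws of the observed variables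
outside of the first block. Functions of that block serve here to single out a component, so its own
laws are reached by exchanging the roles of the two blocks. -/
lemma exists_perm_obsCond_eq_off {M' : LatentModel K J 𝒳} (hM : M.IsBLCM) (hM' : M'.IsBLCM)
    {C : ∀ j, Set (𝒳 j)} (hC : ∀ j, MeasurableSet (C j)) (hmono : M.Monotone C)
    (hobs : M.obsLaw = M'.obsLaw) {r₁ r₂ : Fin K ↪ Fin J}
    (hr : IsDoubleTriangular M.Γ r₁ r₂) (h3 : ThirdBlockNoEmptyColumn M.Γ r₁ r₂) :
    ∃ φ : Equiv.Perm (Fin K → Bool), ∀ j, j ∉ range r₁ → ∀ h,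
      M.obsCond j h = M'.obsCond j (φ h) := by
  classical
  obtain ⟨hdisj, ht1, ht2⟩ := hr
  choose u hu huoff huval using hM.exists_condMean_eq_indicator hC hmono r₁ ht1
  choose w hw hwoff hwval using hM.exists_condMean_eq_indicator hC hmono r₂ ht2
  let π : (Fin K → Bool) → ℝ := fun h => (M.latentProb h).toReal
  let π' : (Fin K → Bool) → ℝ := fun h => (M'.latentProb h).toReal
  have hπ : ∀ h, π h ≠ 0 := fun h =>
    (ENNReal.toReal_pos (hM.latentProb_pos h).ne' (hM.latentProb_ne_top h)).ne'
  have huw : ∀ g h j, u g j = 1 ∨ w h j = 1 := by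
    intro g h j
    by_cases hj : j ∈ range r₁
    · exact Or.inr (hwoff h j (Set.disjoint_left.1 hdisj hj))
    · exact Or.inl (huoff g j hj)
  let A : Matrix (Fin K → Bool) (Fin K → Bool) ℝ := fun h x => M'.condMean (u h) x
  let B : Matrix (Fin K → Bool) (Fin K → Bool) ℝ := fun h x => M'.condMean (w h) x
  have hA : ∀ h x, A h x = M'.condMean (u h) x := fun _ _ => rfl
  have hB : ∀ h x, B h x = M'.condMean (w h) x := fun _ _ => rfl
  have hmean : ∀ f, IsTestFunction f →
      ∑ x, π x * M.condMean f x = ∑ x, π' x * M'.condMean f x := by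
    intro f hf
    rw [← hM.integral_obsLaw hf, ← hM'.integral_obsLaw hf, hobs]
  have key : ∀ v : ∀ j, 𝒳 j → ℝ, IsTestFunction v →
      (∀ j, j ∈ range r₁ ∨ j ∈ range r₂ → v j = 1) →
      A * Matrix.diagonal (π' * M'.condMean v) * B.transpose
        = Matrix.diagonal (π * M.condMean v) := by
    intro v hv hv1
    have huwv : ∀ g h j, (u g * w h) j = 1 ∨ v j = 1 := by
      intro g h j
      by_cases hj : j ∈ range r₁ ∨ j ∈ range r₂
      · exact Or.inr (hv1 j hj)
      · push Not at hj
        left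
        rw [Pi.mul_apply, huoff g j hj.1, hwoff h j hj.2, mul_one]
    ext g h
    have h1 := hmean _ (((hu g).mul (hw h)).mul hv)
    simp only [hM.condMean_mul (huwv g h), hM'.condMean_mul (huwv g h),
      hM.condMean_mul (huw g h), hM'.condMean_mul (huw g h), huval, hwval] at h1
    rw [Matrix.mul_apply]
    simp only [Matrix.mul_diagonal, Matrix.transpose_apply, hA, hB, Pi.mul_apply]
    calc _ = ∑ x, π' x * (M'.condMean (u g) x * M'.condMean (w h) x * M'.condMean v x) :=
          Finset.sum_congr rfl fun x _ => by ring
      _ = _ := by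
        rw [← h1, Finset.sum_eq_single g]
        · by_cases hgh : g = h
          · subst hgh; simp
          · simp [hgh]
        · intro x _ hx; simp [hx]
        · simp
  have hone : A * Matrix.diagonal π' * B.transpose = Matrix.diagonal π := by
    have h1 := key 1 IsTestFunction.one (fun _ _ => rfl)
    have e1 : M.condMean 1 = 1 := funext fun h => hM.condMean_one h
    have e2 : M'.condMean 1 = 1 := funext fun h => hM'.condMean_one h
    rwa [e1, e2, mul_one, mul_one] at h1
  -- The tests of the third factor: indicators of events of single variables outside of both blocks.
  let I := Σ j : {j // j ∉ range r₁ ∧ j ∉ range r₂}, {S : Set (𝒳 j) // MeasurableSet S}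
  obtain ⟨φ, -, hφ⟩ := exists_perm_of_diagonal_factorization (I := I) hπ hone
    (F := fun i => M.condMean (singleTest i.1.1 i.2.1))
    (F' := fun i => M'.condMean (singleTest i.1.1 i.2.1))
    (by
      rintro ⟨⟨j, hj1, hj2⟩, S, hS⟩
      refine key _ (isTestFunction_singleTest hS) fun i hi => ?_
      have hij : i ≠ j := by
        rintro rfl
        exact hi.elim hj1 hj2
      simp [singleTest, hij])
    (by
      intro g h H
      refine hM.eq_of_obsCond_eq_off h3 fun j hj1 hj2 => hM.obsCond_ext hM fun S hS => ?_
      rw [← hM.condMean_singleTest hS, ← hM.condMean_singleTest hS]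
      exact H ⟨⟨j, hj1, hj2⟩, S, hS⟩)
  -- `u h` has mean zero given any configuration of the second model but `φ h`.
  have hval : ∀ f : ∀ j, 𝒳 j → ℝ, IsTestFunction f → (∀ j, j ∈ range r₁ → f j = 1) →
      ∀ h, π h * M.condMean f h = A h (φ h) * π' (φ h) * M'.condMean f (φ h) := by
    intro f hf hf1 h
    have huf : ∀ j, u h j = 1 ∨ f j = 1 := fun j =>
      (em (j ∈ range r₁)).symm.imp (huoff h j) (hf1 j)
    have h1 := hmean _ ((hu h).mul hf)
    simp only [hM.condMean_mul huf, hM'.condMean_mul huf, huval] at h1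
    rw [Finset.sum_eq_single h (fun x _ hx => by simp [hx]) (by simp),
      Finset.sum_eq_single (φ h) (fun x _ hx => ?_) (by simp)] at h1
    · simp only [if_true, one_mul] at h1
      rw [h1, hA]
      ring
    · have := hφ x h hx
      rw [hA] at this
      simp [this]
  refine ⟨φ, fun j hj h => hM.obsCond_ext hM' fun S hS => ?_⟩
  have e1 := hval 1 IsTestFunction.one (fun _ _ => rfl) h
  rw [hM.condMean_one, hM'.condMean_one, mul_one, mul_one] at e1
  have e2 := hval _ (isTestFunction_singleTest hS) (fun i hi => by
    have hij : i ≠ j := by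
      rintro rfl
      exact hj hi
    simp [singleTest, hij]) h
  rw [← e1, hM.condMean_singleTest hS, hM'.condMean_singleTest hS] at e2
  exact mul_left_cancel₀ (hπ h) e2

/-- The mixture components of the observed law are identified up to a bijection between the latent
configurations. -/
lemma exists_perm_obsCond_eq {M' : LatentModel K J 𝒳} (hM : M.IsBLCM) (hM' : M'.IsBLCM)
    {C : ∀ j, Set (𝒳 j)} (hC : ∀ j, MeasurableSet (C j)) (hmono : M.Monotone C)
    (hobs : M.obsLaw = M'.obsLaw) {r₁ r₂ : Fin K ↪ Fin J}
    (hr : IsDoubleTriangular M.Γ r₁ r₂) (h3 : ThirdBlockNoEmptyColumn M.Γ r₁ r₂) :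
    ∃ φ : Equiv.Perm (Fin K → Bool), (∀ j h, M.obsCond j h = M'.obsCond j (φ h)) ∧
      ∀ h, M.latentProb h = M'.latentProb (φ h) := by
  classical
  obtain ⟨φ, hφ⟩ := hM.exists_perm_obsCond_eq_off hM' hC hmono hobs hr h3
  obtain ⟨ψ, hψ⟩ := hM.exists_perm_obsCond_eq_off hM' hC hmono hobs
    (r₁ := r₂) (r₂ := r₁) ⟨hr.1.symm, hr.2.2, hr.2.1⟩
    (fun k => (h3 k).imp fun j hj => ⟨hj.2.1, hj.1, hj.2.2⟩)
  have hψφ : ∀ h, ψ h = φ h := by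
    intro h
    have : φ.symm (ψ h) = h := by
      refine hM.eq_of_obsCond_eq_off h3 fun j hj1 hj2 => ?_
      rw [hφ j hj1, hψ j hj2, Equiv.apply_symm_apply]
    rw [← this, Equiv.apply_symm_apply, this]
  have hall : ∀ j h, M.obsCond j h = M'.obsCond j (φ h) := by
    intro j h
    by_cases hj : j ∈ range r₁
    · rw [hψ j (Set.disjoint_left.1 hr.1 hj) h, hψφ]
    · exact hφ j hj h
  refine ⟨φ, hall, fun h => ?_⟩
  obtain ⟨u, hu, -, huval⟩ := hM.exists_condMean_eq_indicator hC hmono r₁ hr.2.1 h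
  have hcm : ∀ g, M'.condMean u (φ g) = M.condMean u g := fun g => by simp [condMean, hall]
  have h1 : ∑ g, (M.latentProb g).toReal * M.condMean u g
      = ∑ g, (M'.latentProb g).toReal * M'.condMean u g := by
    rw [← hM.integral_obsLaw hu, ← hM'.integral_obsLaw hu, hobs]
  rw [← Equiv.sum_comp φ (fun g => (M'.latentProb g).toReal * M'.condMean u g)] at h1
  simp only [hcm, huval] at h1
  simpa [ENNReal.toReal_eq_toReal_iff' (hM.latentProb_ne_top _) (hM'.latentProb_ne_top _)] using h1

end IsBLCM

end LatentModel

/-! ### From bijections of configurations to permutations of the latent variables -/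

/-- If a bijection of the cube matches, for each row, the partition of the cube given by the columns
of `Γ` in that row with the one given by `Γ'`, then a triangular block of `Γ` is also triangular in
`Γ'`, with the same order of the rows. -/
lemma exists_perm_triangular_of_partition_eq {K J : ℕ} {Γ Γ' : Matrix (Fin J) (Fin K) Bool}
    {φ : Equiv.Perm (Fin K → Bool)}
    (hφ : ∀ j g h, (∀ k, Γ j k = true → g k = h k) ↔ ∀ k, Γ' j k = true → φ g k = φ h k)
    {p : Fin K → Fin J} {c : Equiv.Perm (Fin K)} (hdiag : ∀ i, Γ (p i) (c i) = true)
    (hup : ∀ i l, i < l → Γ (p i) (c l) = false) :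
    ∃ d : Equiv.Perm (Fin K), (∀ i, Γ' (p i) (d i) = true) ∧
      ∀ i l, i < l → Γ' (p i) (d l) = false := by
  -- Changing the `i`-th diagonal coordinate is invisible to the rows before `i` but not to row `i`,
  -- so in `Γ'` row `i` has a column that no earlier row has.
  have hex : ∀ i, ∃ k, Γ' (p i) k = true ∧ ∀ l < i, Γ' (p l) k = false := by
    intro i
    by_contra! H
    have h1 : ∀ l < i, ∀ k, Γ' (p l) k = true →
        φ (fun _ => false) k = φ (Function.update (fun _ => false) (c i) true) k := by
      intro l hl
      refine (hφ _ _ _).1 fun k hk => ?_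
      have hki : k ≠ c i := by
        rintro rfl
        simp [hup l i hl] at hk
      simp [hki]
    have h2 := (hφ (p i) (fun _ => false) (Function.update (fun _ => false) (c i) true)).2
      fun k hk => by
        obtain ⟨l, hl, hlk⟩ := H k hk
        exact h1 l hl k (by simpa using hlk)
    simpa using h2 (c i) (hdiag i)
  choose d hd1 hd2 using hex
  have hinj : Function.Injective d := by
    have hlt : ∀ i l, i < l → d i ≠ d l := by
      intro i l hil H
      have h1 := hd2 l i hil
      rw [← H, hd1 i] at h1
      cases h1
    intro i l H
    rcases lt_trichotomy i l with hil | hil | hil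
    · exact absurd H (hlt i l hil)
    · exact hil
    · exact absurd H.symm (hlt l i hil)
  exact ⟨Equiv.ofBijective d (Finite.injective_iff_bijective.1 hinj), hd1, fun i l hil => hd2 l i hil⟩

namespace LatentModel

variable {K J : ℕ} {𝒳 : Fin J → Type*} [∀ j, MeasurableSpace (𝒳 j)]

lemma IsBLCM.parents_agree_iff {M M' : LatentModel K J 𝒳} (hM : M.IsBLCM) (hM' : M'.IsBLCM)
    {φ : Equiv.Perm (Fin K → Bool)} (hφ : ∀ j h, M.obsCond j h = M'.obsCond j (φ h))
    (j : Fin J) (g h : Fin K → Bool) :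
    (∀ k, M.Γ j k = true → g k = h k) ↔ ∀ k, M'.Γ j k = true → φ g k = φ h k := by
  rw [← hM.obsCond_eq_iff, ← hM'.obsCond_eq_iff, hφ, hφ]

/-- A correspondence of latent configurations that preserves the laws of the observed variables is a
relabelling of the latent variables: triangularity determines each coordinate up to a flip that may
depend on the preceding coordinates, and monotonicity excludes the flips. -/
lemma IsBLCM.exists_perm_apply_eq {M M' : LatentModel K J 𝒳} (hM : M.IsBLCM) (hM' : M'.IsBLCM)
    {C : ∀ j, Set (𝒳 j)} (hmono : M.Monotone C) (hmono' : M'.Monotone C)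
    {φ : Equiv.Perm (Fin K → Bool)} (hφ : ∀ j h, M.obsCond j h = M'.obsCond j (φ h))
    {r : Fin K ↪ Fin J} (hr : IsTriangularUpToPerm (M.Γ.submatrix r id)) :
    ∃ σ : Equiv.Perm (Fin K), ∀ h k, φ h (σ k) = h k := by
  obtain ⟨ρ, c, hdiag, hup⟩ := hr
  simp only [Matrix.submatrix_apply, id_eq] at hdiag hup
  have hpar := hM.parents_agree_iff hM' hφ
  obtain ⟨d, hdiag', hup'⟩ := exists_perm_triangular_of_partition_eq hpar
    (p := fun i => r (ρ i)) hdiag hup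
  have key : ∀ i g h, (∀ k, k ≠ c i → g k = h k) → g (c i) = false → h (c i) = true →
      φ g (d i) = false ∧ φ h (d i) = true := by
    intro i g h hgh hg hh
    have hlt : ∀ l < i, φ g (d l) = φ h (d l) := by
      intro l hl
      refine (hpar (r (ρ l)) g h).1 (fun k hk => hgh k ?_) _ (hdiag' l)
      rintro rfl
      simp [hup l i hl] at hk
    have hoff : ∀ k, k ≠ d i → M'.Γ (r (ρ i)) k = true → φ g k = φ h k := by
      intro k hki hk
      obtain ⟨l, rfl⟩ := d.surjective k
      rcases lt_trichotomy l i with hl | rfl | hl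
      · exact hlt l hl
      · exact absurd rfl hki
      · simp [hup' i l hl] at hk
    have hne : φ g (d i) ≠ φ h (d i) := by
      intro H
      have h1 := (hpar (r (ρ i)) g h).2
        (fun k hk => by
          by_cases hki : k = d i
          · rw [hki, H]
          · exact hoff k hki hk) (c i) (hdiag i)
      simp [hg, hh] at h1
    have hord := hmono.obsCond_lt (hdiag i) (fun k hk _ => hgh k hk) hg hh
    rw [hφ, hφ] at hord
    -- If the images disagreed in the opposite direction, monotonicity of the second model would reverse
    -- the strict inequality between the probabilities of the baseline set.
    have hrev : ¬ (φ h (d i) = false ∧ φ g (d i) = true) := fun H =>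
      hord.not_gt (hmono'.obsCond_lt (hdiag' i) (fun k hk hk' => (hoff k hk hk').symm) H.1 H.2)
    revert hne hrev
    cases φ g (d i) <;> cases φ h (d i) <;> simp
  refine ⟨c.symm.trans d, fun h k => ?_⟩
  obtain ⟨i, rfl⟩ := c.surjective k
  simp only [Equiv.trans_apply, Equiv.symm_apply_apply]
  rcases hi : h (c i) with _ | _
  · exact (key i h (Function.update h (c i) true) (fun k hk => by simp [hk]) hi (by simp)).1
  · exact (key i (Function.update h (c i) false) h (fun k hk => by simp [hk]) (by simp) hi).2

lemma IsBLCM.Γ_eq_of_apply_eq {M M' : LatentModel K J 𝒳} (hM : M.IsBLCM) (hM' : M'.IsBLCM)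
    {φ : Equiv.Perm (Fin K → Bool)} (hφ : ∀ j h, M.obsCond j h = M'.obsCond j (φ h))
    {σ : Equiv.Perm (Fin K)} (hσ : ∀ h k, φ h (σ k) = h k) (j : Fin J) (k : Fin K) :
    M.Γ j k = M'.Γ j (σ k) := by
  have h1 := hM.parents_agree_iff hM' hφ j (fun _ => false) (Function.update (fun _ => false) k true)
  rw [← σ.forall_congr_right (q := fun l => M'.Γ j l = true →
    φ (fun _ => false) l = φ (Function.update (fun _ => false) k true) l)] at h1
  have h2 : ∀ b : Fin K → Bool, (∀ l, b l = true →
      (fun _ => false : Fin K → Bool) l = Function.update (fun _ => false) k true l)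
      ↔ b k = false := by
    intro b
    constructor
    · intro H
      by_contra hb
      simpa using H k (by simpa using hb)
    · intro hb l hl
      have hlk : l ≠ k := by
        rintro rfl
        simp [hb] at hl
      simp [hlk]
  simp only [hσ] at h1
  rw [h2 (fun l => M.Γ j l), h2 (fun l => M'.Γ j (σ l))] at h1
  revert h1
  cases M.Γ j k <;> cases M'.Γ j (σ k) <;> simp

end LatentModel

/-! ### d-separation and conditional independence of the latent variables -/

/-- d-separation inside an embedded graph is d-separation in the whole graph when the vertices outside
of the embedding have no outgoing edges: such a vertex in the interior of a trail is a collider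
without descendants in the conditioning set. -/
lemma dSep_image_iff {V W : Type*} {E : V → V → Prop} {E' : W → W → Prop} (e : V ↪ W)
    (hE : ∀ a b, E' (e a) (e b) ↔ E a b) (hout : ∀ w, w ∉ range e → ∀ x, ¬ E' w x)
    (A B C : Set V) : DSep E' (e '' A) (e '' B) (e '' C) ↔ DSep E A B C := by
  have hmem : ∀ {x d}, Relation.ReflTransGen E' x (e d) → x ∈ range e := by
    intro x d hx
    rcases hx.cases_head with rfl | ⟨y, hxy, -⟩
    · exact mem_range_self d
    · by_contra hxr
      exact hout x hxr y hxy
  have hreach : ∀ b d, Relation.ReflTransGen E' (e b) (e d) ↔ Relation.ReflTransGen E b d := by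
    intro b d
    constructor
    · intro H
      generalize hx : e b = x at H
      induction H using Relation.ReflTransGen.head_induction_on generalizing b with
      | refl => rw [e.injective hx]
      | head hxy hy ih =>
        obtain ⟨y, rfl⟩ := hmem hy
        subst hx
        exact .head ((hE _ _).1 hxy) (ih y rfl)
    · exact fun H => H.lift e fun a b hab => (hE a b).2 hab
  have htrail : ∀ l : List V, IsTrail E' (l.map e) ↔ IsTrail E l := by
    intro l
    simp only [IsTrail, List.nodup_map_iff e.injective, List.isChain_map, hE]
  have hactive : ∀ l : List V, IsActive E' (e '' C) (l.map e) ↔ IsActive E C l := by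
    intro l
    constructor
    · intro H a b c hl
      have := H (e a) (e b) (e c) (by simpa using hl.map e)
      simpa [hE, hreach] using this
    · intro H a b c hl
      obtain ⟨l', hl', hmap⟩ := List.infix_map_iff.1 hl
      match l', hmap with
      | [x, y, z], hmap =>
        simp only [List.map_cons, List.map_nil, List.cons.injEq, and_true] at hmap
        obtain ⟨rfl, rfl, rfl⟩ := hmap
        simpa [hE, hreach] using H x y z hl'
  have hends : ∀ (l : List V) (S : Set V),
      ((∃ a ∈ e '' S, (l.map e).head? = some a) ↔ ∃ a ∈ S, l.head? = some a) ∧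
      ((∃ a ∈ e '' S, (l.map e).getLast? = some a) ↔ ∃ a ∈ S, l.getLast? = some a) := by
    intro l S
    constructor <;> simp
  constructor
  · intro H l hl hA hB hact
    exact H (l.map e) ((htrail l).2 hl) ((hends l A).1.2 hA) ((hends l B).2.2 hB)
      ((hactive l).2 hact)
  · intro H l hl hA hB hact
    -- A vertex outside of the embedding cannot be an end of the trail, so it is a collider on it.
    have hrange : ∀ w ∈ l, w ∈ range e := by
      intro w hw
      by_contra hwr
      obtain ⟨s, t, rfl⟩ := List.append_of_mem hw
      rcases List.eq_nil_or_concat s with rfl | ⟨s, a, rfl⟩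
      · obtain ⟨_, ⟨x, -, rfl⟩, hx⟩ := hA
        simp only [List.nil_append, List.head?_cons, Option.some.injEq] at hx
        exact hwr ⟨x, hx.symm⟩
      rcases t with _ | ⟨c, t⟩
      · obtain ⟨_, ⟨x, -, rfl⟩, hx⟩ := hB
        simp only [List.getLast?_append, List.getLast?_singleton, Option.some_or,
          Option.some.injEq] at hx
        exact hwr ⟨x, hx.symm⟩
      have hinf : [a, w, c] <:+: (s.concat a) ++ w :: c :: t := ⟨s, t, by simp⟩
      have hch := hl.2.infix hinf
      simp only [List.isChain_cons_cons, List.isChain_singleton, and_true] at hch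
      have haw : E' a w := hch.1.resolve_right (hout w hwr a)
      have hcw : E' c w := hch.2.resolve_left (hout w hwr c)
      obtain ⟨_, ⟨d, -, rfl⟩, hd⟩ := (hact a w c hinf).1 ⟨haw, hcw⟩
      exact hwr (hmem hd)
    obtain ⟨l, rfl⟩ : l ∈ range (List.map e) := by
      rw [Set.range_list_map]
      exact hrange
    exact H l ((htrail l).1 hl) ((hends l A).1.1 hA) ((hends l B).2.1 hB) ((hactive l).1 hact)

/-- Change of variables for conditional expectations. -/
lemma condExp_map_comp_ae_eq {Ω Ω' : Type*} {m₀ : MeasurableSpace Ω} {m m₀' : MeasurableSpace Ω'}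
    (hm : m ≤ m₀') (μ : Measure Ω) [IsFiniteMeasure μ] {f : Ω → Ω'} (hf : Measurable f)
    {g : Ω' → ℝ} (hg : Integrable g (μ.map f)) :
    (μ.map f)[g | m] ∘ f =ᵐ[μ] μ[g ∘ f | m.comap f] := by
  have hle : m.comap f ≤ m₀ := (MeasurableSpace.comap_mono hm).trans hf.comap_le
  have hmf : Measurable[m.comap f, m] f := comap_measurable f
  have hint : Integrable ((μ.map f)[g | m] ∘ f) μ := integrable_condExp.comp_measurable hf
  refine ae_eq_condExp_of_forall_setIntegral_eq hle (hg.comp_measurable hf)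
    (fun s _ _ => hint.integrableOn) ?_
    (stronglyMeasurable_condExp.comp_measurable hmf).aestronglyMeasurable
  rintro _ ⟨t, ht, rfl⟩ -
  have h1 := setIntegral_condExp hm hg ht
  rw [setIntegral_map (hm t ht) integrable_condExp.aestronglyMeasurable hf.aemeasurable,
    setIntegral_map (hm t ht) hg.aestronglyMeasurable hf.aemeasurable] at h1
  exact h1

namespace LatentModel

variable {K J : ℕ} {𝒳 : Fin J → Type*} [∀ j, MeasurableSpace (𝒳 j)]

/-- The σ-algebra on the cube generated by the coordinates in `S`. -/
@[reducible] def cubeSigma {K : ℕ} (S : Set (Fin K)) : MeasurableSpace (Fin K → Bool) :=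
  ⨆ k ∈ S, MeasurableSpace.comap (fun h => h k) inferInstance

/-- Conditional independence of the coordinates in `A` and `B` given those in `C`, under a
distribution on the cube. -/
def CubeCondIndep {K : ℕ} (ν : Measure (Fin K → Bool)) (A B C : Set (Fin K)) : Prop :=
  ∀ s t : Set (Fin K → Bool), MeasurableSet[cubeSigma A] s → MeasurableSet[cubeSigma B] t →
    ν⟦s ∩ t | cubeSigma C⟧ =ᵐ[ν] ν⟦s | cubeSigma C⟧ * ν⟦t | cubeSigma C⟧

lemma cubeSigma_le (S : Set (Fin K)) : cubeSigma S ≤ MeasurableSpace.pi :=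
  iSup₂_le fun k _ => (measurable_pi_apply k).comap_le

/-- The vertex `H_k` of the full graph, under a relabelling of the latent variables. -/
def latentVertex (J : ℕ) (σ : Equiv.Perm (Fin K)) : Fin K ↪ Fin K ⊕ Fin J :=
  ⟨fun k => .inl (σ k), fun _ _ h => σ.injective (Sum.inl_injective h)⟩

lemma setSigma_image_latentVertex (σ : Equiv.Perm (Fin K)) (S : Set (Fin K)) :
    setSigma K 𝒳 (latentVertex J σ '' S) =
      (cubeSigma S).comap (fun ω : (Fin K → Bool) × (∀ j, 𝒳 j) => ω.1 ∘ σ) := by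
  rw [setSigma, iSup_image, cubeSigma, MeasurableSpace.comap_iSup]
  refine iSup_congr fun k => ?_
  rw [MeasurableSpace.comap_iSup]
  refine iSup_congr fun _ => ?_
  rw [MeasurableSpace.comap_comp]
  rfl

lemma measurable_latent_comp (σ : Equiv.Perm (Fin K)) :
    Measurable (fun ω : (Fin K → Bool) × (∀ j, 𝒳 j) => ω.1 ∘ σ) :=
  measurable_pi_lambda _ fun k => (measurable_pi_apply (σ k)).comp measurable_fst

/-- The conditional independences between latent variables depend only on the law of `H`. -/
lemma condIndepVars_image_latentVertex_iff (M : LatentModel K J 𝒳) [IsProbabilityMeasure M.law]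
    (σ : Equiv.Perm (Fin K)) (A B C : Set (Fin K)) :
    M.CondIndepVars (latentVertex J σ '' A) (latentVertex J σ '' B) (latentVertex J σ '' C) ↔
      CubeCondIndep (M.law.map (fun ω => ω.1 ∘ σ)) A B C := by
  have hf := measurable_latent_comp (𝒳 := 𝒳) σ
  set f := (fun ω : (Fin K → Bool) × (∀ j, 𝒳 j) => ω.1 ∘ σ)
  have := Measure.isProbabilityMeasure_map (μ := M.law) hf.aemeasurable
  have hce : ∀ s : Set (Fin K → Bool), (M.law.map f)⟦s | cubeSigma C⟧ ∘ f =ᵐ[M.law]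
      M.law⟦f ⁻¹' s | (cubeSigma C).comap f⟧ := fun s =>
    condExp_map_comp_ae_eq (cubeSigma_le C) M.law hf
      ((integrable_const (1 : ℝ)).indicator s.toFinite.measurableSet)
  have hiff : ∀ s t : Set (Fin K → Bool),
      (M.law⟦f ⁻¹' s ∩ f ⁻¹' t | (cubeSigma C).comap f⟧ =ᵐ[M.law]
        M.law⟦f ⁻¹' s | (cubeSigma C).comap f⟧ * M.law⟦f ⁻¹' t | (cubeSigma C).comap f⟧) ↔
      ((M.law.map f)⟦s ∩ t | cubeSigma C⟧ =ᵐ[M.law.map f]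
        (M.law.map f)⟦s | cubeSigma C⟧ * (M.law.map f)⟦t | cubeSigma C⟧) := by
    intro s t
    have h1 : ((M.law.map f)⟦s ∩ t | cubeSigma C⟧ =ᵐ[M.law.map f]
        (M.law.map f)⟦s | cubeSigma C⟧ * (M.law.map f)⟦t | cubeSigma C⟧) ↔
        ((M.law.map f)⟦s ∩ t | cubeSigma C⟧ ∘ f =ᵐ[M.law]
        ((M.law.map f)⟦s | cubeSigma C⟧ ∘ f) * ((M.law.map f)⟦t | cubeSigma C⟧ ∘ f)) :=
      ae_map_iff hf.aemeasurable (Set.toFinite _).measurableSet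
    rw [h1]
    have hp := (hce s).mul (hce t)
    exact ⟨fun H => ((hce (s ∩ t)).trans H).trans hp.symm,
      fun H => ((hce (s ∩ t)).symm.trans H).trans hp⟩
  unfold CondIndepVars CubeCondIndep
  rw [setSigma_image_latentVertex, setSigma_image_latentVertex, setSigma_image_latentVertex]
  constructor
  · intro H s t hs ht
    exact (hiff s t).1 (H _ _ ⟨s, hs, rfl⟩ ⟨t, ht, rfl⟩)
  · rintro H _ _ ⟨s, hs, rfl⟩ ⟨t, ht, rfl⟩
    exact (hiff s t).2 (H s t hs ht)

lemma dSep_latent_iff (M : LatentModel K J 𝒳) (σ : Equiv.Perm (Fin K)) (A B C : Set (Fin K)) :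
    DSep M.edge (latentVertex J σ '' A) (latentVertex J σ '' B) (latentVertex J σ '' C) ↔
      DSep (fun k l => M.Λ (σ k) (σ l)) A B C := by
  refine dSep_image_iff (latentVertex J σ) (fun a b => Iff.rfl) (fun w hw x => ?_) A B C
  rcases w with k | j
  · exact absurd ⟨σ.symm k, congrArg Sum.inl (σ.apply_symm_apply k)⟩ hw
  · cases x <;> exact id

/-- By faithfulness, the d-separations of the latent graph are the conditional independences of the
law of the latent variables. -/
lemma IsBLCM.dSep_latent_iff_cubeCondIndep {M : LatentModel K J 𝒳} (hM : M.IsBLCM)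
    (σ : Equiv.Perm (Fin K)) {A B C : Set (Fin K)} (hAB : Disjoint A B) (hAC : Disjoint A C)
    (hBC : Disjoint B C) :
    DSep (fun k l => M.Λ (σ k) (σ l)) A B C ↔
      CubeCondIndep (M.law.map (fun ω => ω.1 ∘ σ)) A B C := by
  have := hM.isProbabilityMeasure
  have hinj := (latentVertex J σ).injective
  rw [← M.dSep_latent_iff, ← M.condIndepVars_image_latentVertex_iff]
  exact hM.faithful _ _ _ ((disjoint_image_iff hinj).2 hAB) ((disjoint_image_iff hinj).2 hAC)
    ((disjoint_image_iff hinj).2 hBC)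

end LatentModel

/-! ### Identifiability -/

theorem proposition3p5 {K J : ℕ} {𝒳 : Fin J → Type*}
    [∀ j, MetricSpace (𝒳 j)] [∀ j, TopologicalSpace.SeparableSpace (𝒳 j)] [∀ j, Nontrivial (𝒳 j)]
    [∀ j, MeasurableSpace (𝒳 j)] [∀ j, BorelSpace (𝒳 j)]
    (C : ∀ j, Set (𝒳 j)) (hCmeas : ∀ j, MeasurableSet (C j)) (hCne : ∀ j, C j ≠ Set.univ)
    (M : LatentModel K J 𝒳) (hM : M.IsBLCM) (hMmono : M.Monotone C)
    (hΓ : ∃ r₁ r₂ : Fin K ↪ Fin J,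
      IsDoubleTriangular M.Γ r₁ r₂ ∧ ThirdBlockNoEmptyColumn M.Γ r₁ r₂)
    (M' : LatentModel K J 𝒳) (hM' : M'.IsBLCM) (hM'mono : M'.Monotone C)
    (hobs : M.obsLaw = M'.obsLaw) :
    M.EquivUpToLabels M' := by
  obtain ⟨r₁, r₂, hr, h3⟩ := hΓ
  obtain ⟨φ, hφ, hπ⟩ := hM.exists_perm_obsCond_eq hM' hCmeas hMmono hobs hr h3
  obtain ⟨σ, hσ⟩ := hM.exists_perm_apply_eq hM' hMmono hM'mono hφ hr.2.1
  have hφσ : ∀ h, φ h = h ∘ σ.symm := fun h => funext fun k => by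
    simpa using hσ h (σ.symm k)
  refine ⟨σ, fun h => by rw [hπ, hφσ], hM.Γ_eq_of_apply_eq hM' hφ hσ,
    fun j h => by rw [hφ, hφσ], fun A B S hAB hAS hBS => ?_⟩
  have hlaw : M.law.map (fun ω => ω.1 ∘ (1 : Equiv.Perm (Fin K)))
      = M'.law.map (fun ω => ω.1 ∘ σ) := by
    refine Measure.ext_of_singleton fun h => ?_
    rw [Measure.map_apply (LatentModel.measurable_latent_comp 1) (measurableSet_singleton h),
      Measure.map_apply (LatentModel.measurable_latent_comp σ) (measurableSet_singleton h)]
    have h1 := hπ h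
    rw [hφσ] at h1
    refine h1.trans (congrArg M'.law ?_)
    ext ω
    exact (Equiv.eq_comp_symm σ ω.1 h)
  exact (hM.dSep_latent_iff_cubeCondIndep 1 hAB hAS hBS).trans
    (hlaw ▸ (hM'.dSep_latent_iff_cubeCondIndep σ hAB hAS hBS).symm)
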